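/- Let $n\ge 1$ and let $B_n=\langle \sigma_1,\dots,\sigma_{n-1}\mid \sigma_i\sigma_j=\sigma_j\sigma_i\ (|i-j|>1),\ \sigma_i\sigma_j\sigma_i=\sigma_j\sigma_i\sigma_j\ (|i-j|=1)\rangle$ be the braid group on $n$ strands, and let $\varepsilon\in\mathrm{Aut}(B_n)$ be the automorphism $\sigma_i\mapsto\sigma_i^{-1}$. Two braids $u,v$ are $\varepsilon$-twisted conjugated if $v=\varepsilon(w)^{-1}uw$ for some $w\in B_n$. A braid is positive if it is a (possibly empty) product of the generators $\sigma_i$; a positive braid $x$ is palindromic-free if $\sigma_i^{-1}x\sigma_i^{-1}$ is not positive for every $i=1,\dots,n-1$. Write $a\preccurlyeq b$ if $a^{-1}b$ is positive, let $\wedge$ be the greatest common divisor for $\preccurlyeq$, and let $\Delta=\sigma_1(\sigma_2\sigma_1)\cdots(\sigma_{n-1}\cdots\sigma_1)$. A simple element is an $s$ with $1\preccurlyeq s\preccurlyeq\Delta$; it is proper if $s\ne 1,\Delta$. For $n\ge 2$, the canonical length $\ell(x)$ of $x\in B_n$ is the number $r$ of factors $x_i$ in its left normal form $x=\Delta^p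 x_1\cdots x_r$, where $p$ is the maximal integer such that $\Delta^{-p}x$ is positive, each $x_i$ is a proper simple element, and $x_{i+1}\wedge (x_i^{-1}\Delta)=1$ for $1\le i<r$. (For $n=1$ the group is trivial, and one sets $\ell(1)=0$.) For $x\in B_n$ let $MPF(x)$ be the set of those elements that have minimal canonical length among all positive, palindromic-free braids that are $\varepsilon$-twisted conjugated to $x$. Proposition. For every $x\in B_n$, the set $MPF(x)$ is nonempty and finite, and it is an invariant of the $\varepsilon$-twisted conjugacy class of $x$: if $y\in B_n$ is $\varepsilon$-twisted conjugated to $x$, then $MPF(x)=MPF(y)$. -/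

import Mathlib

/-- `u` and `v` are `φ`-twisted conjugated: `v = (φ x)⁻¹ u x` for some `x`. -/
def TwistedConj {G : Type*} [Group G] (φ : MulAut G) (u v : G) : Prop :=
  ∃ x : G, v = (φ x)⁻¹ * u * x

/-- The relators of the classical presentation of the braid group on `n` strands; the generators
`σ_1, …, σ_{n-1}` are indexed from `0` by `Fin (n - 1)`. -/
def braidRels (n : ℕ) : Set (FreeGroup (Fin (n - 1))) :=
  {r | ∃ i j : Fin (n - 1), 1 < |(i : ℤ) - (j : ℤ)| ∧
      r = (FreeGroup.of i * FreeGroup.of j) * (FreeGroup.of j * FreeGroup.of i)⁻¹} ∪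
  {r | ∃ i j : Fin (n - 1), |(i : ℤ) - (j : ℤ)| = 1 ∧
      r = (FreeGroup.of i * FreeGroup.of j * FreeGroup.of i) *
        (FreeGroup.of j * FreeGroup.of i * FreeGroup.of j)⁻¹}

/-- The braid group `B_n` on `n` strands. -/
abbrev BraidGroup (n : ℕ) : Type := PresentedGroup (braidRels n)

namespace BraidGroup

variable {n : ℕ}

/-- The standard generators. -/
def sigma (i : Fin (n - 1)) : BraidGroup n := PresentedGroup.of i

theorem sigma_comm {i j : Fin (n - 1)} (h : 1 < |(i : ℤ) - (j : ℤ)|) :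
    (sigma i : BraidGroup n) * sigma j = sigma j * sigma i := by
  have := PresentedGroup.one_of_mem (rels := braidRels n) (Or.inl ⟨i, j, h, rfl⟩)
  rw [map_mul, map_inv, mul_inv_eq_one] at this
  simp only [map_mul] at this
  exact this

theorem sigma_braid {i j : Fin (n - 1)} (h : |(i : ℤ) - (j : ℤ)| = 1) :
    (sigma i : BraidGroup n) * sigma j * sigma i = sigma j * sigma i * sigma j := by
  have := PresentedGroup.one_of_mem (rels := braidRels n) (Or.inr ⟨i, j, h, rfl⟩)
  rw [map_mul, map_inv, mul_inv_eq_one] at this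
  simp only [map_mul] at this
  exact this

/-- The endomorphism of `B_n` that sends each generator to its inverse. -/
def epsilonHom (n : ℕ) : BraidGroup n →* BraidGroup n :=
  PresentedGroup.toGroup (f := fun i => (sigma i : BraidGroup n)⁻¹) (by
    rintro r (⟨i, j, h, rfl⟩ | ⟨i, j, h, rfl⟩)
    · simp only [map_mul, map_inv, FreeGroup.lift_apply_of, mul_inv_eq_one]
      rw [← mul_inv_rev, ← mul_inv_rev, sigma_comm h]
    · simp only [map_mul, map_inv, FreeGroup.lift_apply_of, mul_inv_eq_one]
      rw [← mul_inv_rev, ← mul_inv_rev, ← mul_inv_rev, ← mul_inv_rev, ← mul_assoc, ← mul_assoc,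
        sigma_braid h])

theorem epsilonHom_sigma (i : Fin (n - 1)) : epsilonHom n (sigma i) = (sigma i)⁻¹ :=
  PresentedGroup.toGroup.of _

theorem epsilonHom_comp_self (n : ℕ) :
    (epsilonHom n).comp (epsilonHom n) = MonoidHom.id (BraidGroup n) := by
  refine PresentedGroup.ext fun i => ?_
  change epsilonHom n (epsilonHom n (sigma i)) = sigma i
  rw [epsilonHom_sigma, map_inv, epsilonHom_sigma, inv_inv]

/-- The automorphism `ε` of `B_n` that sends each generator to its inverse. -/
def epsilon (n : ℕ) : MulAut (BraidGroup n) :=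
  (epsilonHom n).toMulEquiv (epsilonHom n) (epsilonHom_comp_self n) (epsilonHom_comp_self n)

/-- A braid is positive if it is a product of generators (the empty product is allowed). -/
def IsPositive (x : BraidGroup n) : Prop :=
  x ∈ Submonoid.closure (Set.range (sigma : Fin (n - 1) → BraidGroup n))

/-- The prefix order: `a ≼ b` iff `a⁻¹ b` is positive. -/
def IsPrefix (a b : BraidGroup n) : Prop := IsPositive (a⁻¹ * b)

/-- The half twist `Δ = σ_1 (σ_2 σ_1) (σ_3 σ_2 σ_1) ⋯ (σ_{n-1} ⋯ σ_1)`. -/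
def garside (n : ℕ) : BraidGroup n :=
  ((List.finRange (n - 1)).map fun k =>
    (((List.finRange (n - 1)).filter (· ≤ k)).reverse.map sigma).prod).prod

/-- Simple elements: the `s` with `1 ≼ s ≼ Δ`. -/
def IsSimple (s : BraidGroup n) : Prop := IsPrefix 1 s ∧ IsPrefix s (garside n)

/-- Proper simple elements: those different from `1` and `Δ`. -/
def IsProperSimple (s : BraidGroup n) : Prop := IsSimple s ∧ s ≠ 1 ∧ s ≠ garside n

/-- The right complement `∂(s) = s⁻¹ Δ`. -/
def rightComplement (s : BraidGroup n) : BraidGroup n := s⁻¹ * garside n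

/-- The product `s t` of two simple elements is left weighted: `t ∧ ∂(s) = 1`, that is, the only
positive common prefix of `t` and `∂(s)` is `1`. -/
def IsLeftWeighted (s t : BraidGroup n) : Prop :=
  ∀ a : BraidGroup n, IsPositive a → IsPrefix a t → IsPrefix a (rightComplement s) → a = 1

/-- `x = Δ^p x_1 ⋯ x_r`, with `l = [x_1, …, x_r]`, is the left normal form of `x`. -/
structure IsLeftNormalForm (x : BraidGroup n) (p : ℤ) (l : List (BraidGroup n)) : Prop where
  eq_prod : x = garside n ^ p * l.prod
  isGreatest : IsGreatest {q : ℤ | IsPositive (garside n ^ (-q) * x)} p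
  proper : ∀ s ∈ l, IsProperSimple s
  leftWeighted : l.IsChain IsLeftWeighted

/-- The canonical length of `x`: the number of factors in its left normal form. (For `n ≤ 1` the
group is trivial and its element has no left normal form; it gets canonical length `0`.) -/
noncomputable def canonicalLength (x : BraidGroup n) : ℕ :=
  sInf {r : ℕ | ∃ (p : ℤ) (l : List (BraidGroup n)), IsLeftNormalForm x p l ∧ l.length = r}

/-- A positive braid `x` is palindromic-free if no `σ_i⁻¹ x σ_i⁻¹` is positive. -/
def IsPositivePalindromicFree (x : BraidGroup n) : Prop :=
  IsPositive x ∧ ∀ i : Fin (n - 1), ¬ IsPositive ((sigma i)⁻¹ * x * (sigma i)⁻¹)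

/-- The positive, palindromic-free braids that are `ε`-twisted conjugated to `x`. -/
def PF (x : BraidGroup n) : Set (BraidGroup n) :=
  {y | IsPositivePalindromicFree y ∧ TwistedConj (epsilon n) x y}

/-- The elements of minimal canonical length among the positive, palindromic-free braids that are
`ε`-twisted conjugated to `x`. -/
def MPF (x : BraidGroup n) : Set (BraidGroup n) :=
  {y | y ∈ PF x ∧ ∀ z ∈ PF x, canonicalLength y ≤ canonicalLength z}

end BraidGroup

/-! The map `w ↦ (ε w)⁻¹` is the anti-automorphism reversing words, so twisted conjugation replaces
`x` by `rev(w) x w`. Taking `w = Δ ^ k` with `k` large makes any braid positive. Whenever `σ_i⁻¹ x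
σ_i⁻¹` is still positive, passing to it is a twisted conjugation (`w = σ_i⁻¹`) that lowers the
exponent sum by 2, so the process stops at a palindromic-free braid. Hence `PF x` is nonempty, and
canonical length attains a minimum on it.

Finiteness rests on `IsPositivePalindromicFree.eq_garside`: a positive palindromic-free braid
divisible by `Δ` equals `Δ`. Otherwise its normal form has no power of `Δ`, so canonical length
bounds exponent sum, and only finitely many positive braids have bounded exponent sum. Invariance
holds because twisted conjugacy is an equivalence relation.

Only the existence of normal forms is needed, by a greedy choice of simple prefixes; neither
uniqueness nor the lattice property of `≼` enters. -/

namespace TwistedConj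

variable {G : Type*} [Group G] {φ : MulAut G} {u v w : G}

theorem refl (φ : MulAut G) (u : G) : TwistedConj φ u u := ⟨1, by simp⟩

theorem symm (h : TwistedConj φ u v) : TwistedConj φ v u := by
  obtain ⟨x, rfl⟩ := h
  exact ⟨x⁻¹, by simp [mul_assoc]⟩

theorem trans (h : TwistedConj φ u v) (h' : TwistedConj φ v w) : TwistedConj φ u w := by
  obtain ⟨x, rfl⟩ := h
  obtain ⟨y, rfl⟩ := h'
  exact ⟨x * y, by simp [mul_assoc]⟩

end TwistedConj

/-! ### Half twists from the braid relations -/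

/-- The first `m` terms of the sequence `s` satisfy the braid relations. -/
structure IsBraidSeq {G : Type*} [Group G] (s : ℕ → G) (m : ℕ) : Prop where
  comm : ∀ i j, i + 1 < j → j < m → s i * s j = s j * s i
  braid : ∀ i, i + 1 < m → s i * s (i + 1) * s i = s (i + 1) * s i * s (i + 1)

namespace IsBraidSeq

variable {G : Type*} [Group G]

/-- The product `s k * ⋯ * s 1 * s 0`. -/
def desc (s : ℕ → G) : ℕ → G
  | 0 => s 0
  | k + 1 => s (k + 1) * desc s k

/-- The half twist on the first `k` terms of `s`. -/
def halfTwist (s : ℕ → G) : ℕ → G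
  | 0 => 1
  | k + 1 => halfTwist s k * desc s k

variable {s : ℕ → G} {m : ℕ}

theorem commute_desc (h : IsBraidSeq s m) {j k : ℕ} (hk : k + 1 < j) (hj : j < m) :
    s j * desc s k = desc s k * s j := by
  induction k with
  | zero => exact (h.comm 0 j hk hj).symm
  | succ k ih =>
    rw [desc, ← mul_assoc, ← h.comm (k + 1) j hk hj, mul_assoc, ih (by omega), mul_assoc]

theorem commute_halfTwist (h : IsBraidSeq s m) {j k : ℕ} (hk : k < j) (hj : j < m) :
    s j * halfTwist s k = halfTwist s k * s j := by
  induction k with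
  | zero => simp [halfTwist]
  | succ k ih =>
    rw [halfTwist, ← mul_assoc, ih (by omega), mul_assoc, h.commute_desc hk hj, mul_assoc]

/-- One braid relation, between `s (i + 1)` and `s i`, lowers the index; all other factors commute
past. -/
theorem desc_mul (h : IsBraidSeq s m) {i k : ℕ} (hi : i < k) (hk : k < m) :
    desc s k * s (i + 1) = s i * desc s k := by
  induction k with
  | zero => omega
  | succ k ih =>
    rcases Nat.lt_succ_iff_lt_or_eq.1 hi with hi | rfl
    · rw [desc, mul_assoc, ih hi (by omega), ← mul_assoc, ← h.comm i (k + 1) (by omega) hk,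
        mul_assoc]
    · rcases i with _ | i
      · simpa [desc, mul_assoc] using (h.braid 0 hk).symm
      · have h1 := h.commute_desc (k := i) (j := i + 1 + 1) (by omega) hk
        have h2 := h.braid (i + 1) hk
        simp only [desc]
        rw [mul_assoc, mul_assoc, ← h1, ← mul_assoc, ← mul_assoc, ← mul_assoc, ← mul_assoc, h2]

theorem desc_mul_desc (h : IsBraidSeq s m) {j k : ℕ} (hj : j < k) (hk : k < m) :
    desc s k * desc s (j + 1) = desc s j * desc s k * s 0 := by
  induction j with
  | zero => simp only [desc]; rw [← mul_assoc, h.desc_mul hj hk]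
  | succ j ih =>
    rw [desc, ← mul_assoc, h.desc_mul hj hk, mul_assoc, ih (by omega), desc]
    simp only [mul_assoc]

theorem halfTwist_mul_zero (h : IsBraidSeq s m) {k : ℕ} (hk : k < m) :
    halfTwist s (k + 1) * s 0 = s k * halfTwist s (k + 1) := by
  rcases k with _ | k
  · simp [halfTwist, desc]
  · have h1 := h.desc_mul_desc (Nat.lt_succ_self k) hk
    have h2 := h.commute_halfTwist (Nat.lt_succ_self k) hk
    calc halfTwist s (k + 1 + 1) * s 0 = halfTwist s k * (desc s k * desc s (k + 1) * s 0) := by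
          simp only [halfTwist, mul_assoc]
      _ = halfTwist s k * s (k + 1) * desc s k * desc s (k + 1) := by
          rw [← h1]; simp only [desc, mul_assoc]
      _ = s (k + 1) * halfTwist s (k + 1 + 1) := by
          rw [← h2]; simp only [halfTwist, mul_assoc]

/-- The last `desc` factor lowers a positive index by one, and the smaller half twist then flips it;
index `0` is the separate case `halfTwist_mul_zero`. -/
theorem halfTwist_mul (h : IsBraidSeq s m) {i k : ℕ} (hi : i < k) (hk : k ≤ m) :
    halfTwist s k * s i = s (k - 1 - i) * halfTwist s k := by
  induction k generalizing i with
  | zero => omega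
  | succ k ih =>
    rcases i with _ | i
    · exact h.halfTwist_mul_zero hk
    · rw [halfTwist, mul_assoc, h.desc_mul (by omega) hk, ← mul_assoc, ih (by omega) (by omega),
        mul_assoc]
      congr 2
      omega

theorem desc_mem {S : Submonoid G} (hS : ∀ i, s i ∈ S) (k : ℕ) : desc s k ∈ S := by
  induction k with
  | zero => exact hS 0
  | succ k ih => exact S.mul_mem (hS _) ih

theorem halfTwist_mem {S : Submonoid G} (hS : ∀ i, s i ∈ S) (k : ℕ) : halfTwist s k ∈ S := by
  induction k with
  | zero => exact S.one_mem
  | succ k ih => exact S.mul_mem ih (desc_mem hS k)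

theorem desc_mul_inv_mem {S : Submonoid G} (hS : ∀ i, s i ∈ S) (k : ℕ) :
    desc s k * (s 0)⁻¹ ∈ S := by
  induction k with
  | zero => simp [desc]
  | succ k ih => rw [desc, mul_assoc]; exact S.mul_mem (hS _) ih

theorem inv_mul_halfTwist_mem (h : IsBraidSeq s m) {S : Submonoid G} (hS : ∀ i, s i ∈ S)
    {i k : ℕ} (hi : i < k) (hk : k ≤ m) : (s i)⁻¹ * halfTwist s k ∈ S := by
  induction k with
  | zero => omega
  | succ k ih =>
    rcases Nat.lt_succ_iff_lt_or_eq.1 hi with hi | rfl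
    · rw [halfTwist, ← mul_assoc]
      exact S.mul_mem (ih hi (by omega)) (desc_mem hS k)
    -- For the top index, the flip turns left division by `s i` into right division by `s 0`, the
    -- last letter of `desc s i`.
    · have : (s i)⁻¹ * halfTwist s (i + 1) = halfTwist s (i + 1) * (s 0)⁻¹ := by
        rw [inv_mul_eq_iff_eq_mul, ← mul_assoc, ← h.halfTwist_mul_zero hk, mul_inv_cancel_right]
      rw [this, halfTwist, mul_assoc]
      exact S.mul_mem (halfTwist_mem hS i) (desc_mul_inv_mem hS i)

theorem prod_reverse_range (s : ℕ → G) (k : ℕ) :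
    ((List.range (k + 1)).reverse.map s).prod = desc s k := by
  induction k with
  | zero => simp [desc]
  | succ k ih => rw [List.range_succ, List.reverse_append]; simp [desc, ← ih]

theorem prod_range_desc (s : ℕ → G) (k : ℕ) :
    ((List.range k).map (desc s)).prod = halfTwist s k := by
  induction k with
  | zero => simp [halfTwist]
  | succ k ih => rw [List.range_succ]; simp [halfTwist, ← ih]

end IsBraidSeq

/-! ### The half twist of the braid group -/

namespace BraidGroup

variable {n : ℕ}

/-- The generators as a sequence indexed by `ℕ`, equal to `1` out of range. -/
def sigmaSeq (n : ℕ) (i : ℕ) : BraidGroup n := if h : i < n - 1 then sigma ⟨i, h⟩ else 1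

theorem sigmaSeq_val (i : Fin (n - 1)) : sigmaSeq n i = sigma i := by simp [sigmaSeq]

theorem isBraidSeq_sigmaSeq (n : ℕ) : IsBraidSeq (sigmaSeq n) (n - 1) where
  comm i j hij hj := by
    have hi : i < n - 1 := by omega
    simp only [sigmaSeq, hi, hj, dif_pos]
    apply sigma_comm
    rw [lt_abs]
    right
    simp only
    omega
  braid i hi := by
    have hi' : i < n - 1 := by omega
    simp only [sigmaSeq, hi, hi', dif_pos]
    apply sigma_braid
    simp

theorem garside_eq_halfTwist (n : ℕ) :
    garside n = IsBraidSeq.halfTwist (sigmaSeq n) (n - 1) := by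
  have key (k : Fin (n - 1)) :
      (((List.finRange (n - 1)).filter (· ≤ k)).reverse.map sigma).prod =
        IsBraidSeq.desc (sigmaSeq n) k := by
    have h1 : ((List.finRange (n - 1)).filter (· ≤ k)).map (fun i : Fin (n - 1) => (i : ℕ)) =
        List.range (k + 1) := by
      have h2 : ((List.finRange (n - 1)).filter (· ≤ k)).map (fun i : Fin (n - 1) => (i : ℕ)) =
          (List.range (n - 1)).filter (· ≤ (k : ℕ)) := by
        rw [← List.map_coe_finRange_eq_range, List.filter_map]
        rfl
      rw [h2]
      -- Two strictly increasing lists with the same elements coincide.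
      apply List.Perm.eq_of_pairwise (le := (· < ·))
      · intro a b _ _ h h'
        omega
      · exact List.Pairwise.filter _ List.pairwise_lt_range
      · exact List.pairwise_lt_range
      · rw [List.perm_ext_iff_of_nodup (List.nodup_range.filter _) List.nodup_range]
        intro a
        have := k.2
        simp only [List.mem_filter, List.mem_range, decide_eq_true_eq]
        omega
    rw [← IsBraidSeq.prod_reverse_range, ← h1, ← List.map_reverse, List.map_map]
    congr 2
    funext i
    exact (sigmaSeq_val i).symm
  rw [garside, ← IsBraidSeq.prod_range_desc, ← List.map_coe_finRange_eq_range, List.map_map]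
  congr 2
  funext k
  exact key k

/-! ### Positive braids and `Δ` -/

theorem isPositive_one : IsPositive (1 : BraidGroup n) := Submonoid.one_mem _

theorem IsPositive.mul {x y : BraidGroup n} (hx : IsPositive x) (hy : IsPositive y) :
    IsPositive (x * y) := Submonoid.mul_mem _ hx hy

theorem IsPositive.pow {x : BraidGroup n} (hx : IsPositive x) (k : ℕ) : IsPositive (x ^ k) :=
  Submonoid.pow_mem _ hx k

theorem isPositive_list_prod {l : List (BraidGroup n)} (h : ∀ s ∈ l, IsPositive s) :
    IsPositive l.prod := Submonoid.list_prod_mem _ h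

theorem isPositive_sigma (i : Fin (n - 1)) : IsPositive (sigma i : BraidGroup n) :=
  Submonoid.subset_closure ⟨i, rfl⟩

theorem sigmaSeq_mem (i : ℕ) : sigmaSeq n i ∈
    Submonoid.closure (Set.range (sigma : Fin (n - 1) → BraidGroup n)) := by
  unfold sigmaSeq
  split_ifs with h
  · exact isPositive_sigma _
  · exact isPositive_one

theorem isPositive_garside (n : ℕ) : IsPositive (garside n) := by
  rw [garside_eq_halfTwist]
  exact IsBraidSeq.halfTwist_mem sigmaSeq_mem _

theorem isPrefix_sigma_garside (i : Fin (n - 1)) : IsPrefix (sigma i) (garside n) := by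
  rw [IsPrefix, garside_eq_halfTwist, ← sigmaSeq_val]
  exact (isBraidSeq_sigmaSeq n).inv_mul_halfTwist_mem sigmaSeq_mem i.2 le_rfl

theorem garside_mul_sigma (i : Fin (n - 1)) :
    garside n * sigma i = sigma i.rev * garside n := by
  rw [garside_eq_halfTwist, ← sigmaSeq_val, ← sigmaSeq_val,
    (isBraidSeq_sigmaSeq n).halfTwist_mul i.2 le_rfl, Fin.val_rev]
  congr 2
  omega

/-- Conjugation by the half twist preserves positivity. -/
theorem IsPositive.conj_garside {x : BraidGroup n} (hx : IsPositive x) :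
    IsPositive ((garside n)⁻¹ * x * garside n) := by
  induction hx using Submonoid.closure_induction with
  | mem x hx =>
    obtain ⟨i, rfl⟩ := hx
    have h := garside_mul_sigma i.rev
    rw [Fin.rev_rev] at h
    rw [mul_assoc, ← h, inv_mul_cancel_left]
    exact isPositive_sigma _
  | one => simpa using isPositive_one
  | mul x y _ _ ihx ihy =>
    convert ihx.mul ihy using 1
    group

/-! ### Exponent sum, the word length of positive braids -/

/-- The exponent sum of a braid. -/
def exponentHom (n : ℕ) : BraidGroup n →* Multiplicative ℤ :=
  PresentedGroup.toGroup (f := fun _ => Multiplicative.ofAdd 1) (by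
    rintro r (⟨i, j, h, rfl⟩ | ⟨i, j, h, rfl⟩) <;> simp)

/-- The exponent sum of a braid, as an integer. -/
def exponentSum (x : BraidGroup n) : ℤ := (exponentHom n x).toAdd

@[simp] theorem exponentSum_one : exponentSum (1 : BraidGroup n) = 0 := by simp [exponentSum]

@[simp] theorem exponentSum_mul (x y : BraidGroup n) :
    exponentSum (x * y) = exponentSum x + exponentSum y := by simp [exponentSum]

@[simp] theorem exponentSum_inv (x : BraidGroup n) : exponentSum x⁻¹ = -exponentSum x := by
  simp [exponentSum]

@[simp] theorem exponentSum_zpow (x : BraidGroup n) (k : ℤ) :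
    exponentSum (x ^ k) = k * exponentSum x := by
  simp [exponentSum]

@[simp] theorem exponentSum_sigma (i : Fin (n - 1)) :
    exponentSum (sigma i : BraidGroup n) = 1 := by
  have : exponentHom n (sigma i) = Multiplicative.ofAdd 1 := PresentedGroup.toGroup.of _
  simp [exponentSum, this]

theorem IsPositive.exponentSum_nonneg {x : BraidGroup n} (hx : IsPositive x) :
    0 ≤ exponentSum x := by
  induction hx using Submonoid.closure_induction with
  | mem x hx => obtain ⟨i, rfl⟩ := hx; simp
  | one => simp
  | mul x y _ _ ihx ihy => rw [exponentSum_mul]; omega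

theorem IsPositive.eq_one_or_sigma_mul {x : BraidGroup n} (hx : IsPositive x) :
    x = 1 ∨ ∃ i y, IsPositive y ∧ x = sigma i * y := by
  induction hx using Submonoid.closure_induction_left with
  | one => exact Or.inl rfl
  | mul_left a ha y hy _ =>
    obtain ⟨i, rfl⟩ := ha
    exact Or.inr ⟨i, y, hy, rfl⟩

theorem IsPositive.eq_one_or_mul_sigma {x : BraidGroup n} (hx : IsPositive x) :
    x = 1 ∨ ∃ i y, IsPositive y ∧ x = y * sigma i := by
  induction hx using Submonoid.closure_induction_right with
  | one => exact Or.inl rfl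
  | mul_right y hy a ha _ =>
    obtain ⟨i, rfl⟩ := ha
    exact Or.inr ⟨i, y, hy, rfl⟩

theorem IsPositive.eq_one {x : BraidGroup n} (hx : IsPositive x) (h : exponentSum x ≤ 0) :
    x = 1 := by
  rcases hx.eq_one_or_sigma_mul with rfl | ⟨i, y, hy, rfl⟩
  · rfl
  · have := hy.exponentSum_nonneg
    rw [exponentSum_mul, exponentSum_sigma] at h
    omega

/-- There are only finitely many positive braids of bounded exponent sum. -/
theorem finite_isPositive_exponentSum_le (k : ℤ) :
    {x : BraidGroup n | IsPositive x ∧ exponentSum x ≤ k}.Finite := by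
  suffices h : ∀ k : ℕ, {x : BraidGroup n | IsPositive x ∧ exponentSum x ≤ k}.Finite from
    (h k.toNat).subset fun x hx => ⟨hx.1, hx.2.trans (Int.self_le_toNat k)⟩
  intro k
  induction k with
  | zero =>
    refine (Set.finite_singleton 1).subset fun x hx => hx.1.eq_one ?_
    exact_mod_cast hx.2
  | succ k ih =>
    refine ((Set.finite_singleton 1).union
      (Set.finite_iUnion fun i : Fin (n - 1) => ih.image (sigma i * ·))).subset ?_
    rintro x ⟨hx, hk⟩
    rcases hx.eq_one_or_sigma_mul with rfl | ⟨i, y, hy, rfl⟩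
    · exact Or.inl rfl
    · refine Or.inr (Set.mem_iUnion.2 ⟨i, y, ⟨hy, ?_⟩, rfl⟩)
      rw [exponentSum_mul, exponentSum_sigma] at hk
      push_cast at hk
      omega

/-! ### Simple elements and existence of normal forms -/

theorem IsSimple.isPositive {s : BraidGroup n} (hs : IsSimple s) : IsPositive s := by
  simpa [IsPrefix] using hs.1

theorem IsSimple.exponentSum_le {s : BraidGroup n} (hs : IsSimple s) :
    exponentSum s ≤ exponentSum (garside n) := by
  have := hs.2.exponentSum_nonneg
  rw [exponentSum_mul, exponentSum_inv] at this
  omega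

theorem finite_isSimple (n : ℕ) : {s : BraidGroup n | IsSimple s}.Finite :=
  (finite_isPositive_exponentSum_le (exponentSum (garside n))).subset fun _ hs =>
    ⟨hs.isPositive, hs.exponentSum_le⟩

theorem isSimple_one : IsSimple (1 : BraidGroup n) := by
  simpa [IsSimple, IsPrefix] using ⟨isPositive_one, isPositive_garside n⟩

theorem isSimple_sigma (i : Fin (n - 1)) : IsSimple (sigma i : BraidGroup n) := by
  refine ⟨?_, isPrefix_sigma_garside i⟩
  simpa [IsPrefix] using isPositive_sigma i

/-- A positive braid has a simple prefix of greatest exponent sum. -/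
theorem IsPositive.exists_greatest_simple_prefix {x : BraidGroup n} (hx : IsPositive x) :
    ∃ s, IsSimple s ∧ IsPrefix s x ∧
      ∀ t, IsSimple t → IsPrefix t x → exponentSum t ≤ exponentSum s := by
  obtain ⟨s, hs, h⟩ := Set.exists_max_image {s | IsSimple s ∧ IsPrefix s x} exponentSum
    ((finite_isSimple n).subset fun _ h => h.1) ⟨1, isSimple_one, by simpa [IsPrefix] using hx⟩
  exact ⟨s, hs.1, hs.2, fun t ht ht' => h t ⟨ht, ht'⟩⟩

/-- A positive braid without prefix `Δ` is the product of a left weighted list of proper simple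
elements. -/
theorem IsPositive.exists_leftWeighted {x : BraidGroup n} (hx : IsPositive x)
    (hΔ : ¬ IsPrefix (garside n) x) :
    ∃ l : List (BraidGroup n), x = l.prod ∧ (∀ s ∈ l, IsProperSimple s) ∧
      l.IsChain IsLeftWeighted := by
  obtain ⟨k, hk⟩ : ∃ k : ℕ, exponentSum x ≤ k := ⟨_, Int.self_le_toNat _⟩
  induction k generalizing x with
  | zero => exact ⟨[], by simpa using hx.eq_one (by exact_mod_cast hk), by simp, by simp⟩
  | succ k ih =>
    by_cases hx1 : x = 1
    · exact ⟨[], by simpa using hx1, by simp, by simp⟩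
    obtain ⟨s, hs, hsx, hmax⟩ := hx.exists_greatest_simple_prefix
    have hs1 : 1 ≤ exponentSum s := by
      rcases hx.eq_one_or_sigma_mul with h | ⟨i, y, hy, h⟩
      · exact absurd h hx1
      · simpa using hmax (sigma i) (isSimple_sigma i) (by simpa [IsPrefix, h] using hy)
    have hsΔ : s ≠ garside n := by
      rintro rfl
      exact hΔ hsx
    obtain ⟨l, hl, hprop, hchain⟩ := ih (x := s⁻¹ * x) hsx (by
      intro h
      apply hΔ
      -- `Δ⁻¹ x = (Δ⁻¹ s Δ) (Δ⁻¹ s⁻¹ x)`, so a prefix `Δ` of the remainder would already be a prefix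
      -- of `x`.
      have := hs.isPositive.conj_garside.mul h
      rw [IsPrefix]
      convert this using 1
      group) (by
      rw [exponentSum_mul, exponentSum_inv]
      push_cast at hk
      omega)
    refine ⟨s :: l, by rw [List.prod_cons, ← hl, mul_inv_cancel_left], ?_, ?_⟩
    · intro t ht
      rcases List.mem_cons.1 ht with rfl | ht
      · refine ⟨hs, ?_, hsΔ⟩
        rintro rfl
        simp at hs1
      · exact hprop t ht
    · rw [List.isChain_cons]
      refine ⟨fun t ht a ha hat has => ?_, hchain⟩
      have htl : IsPositive (t⁻¹ * (s⁻¹ * x)) := by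
        rcases l with _ | ⟨t', l⟩
        · simp at ht
        · obtain rfl : t' = t := by simpa using ht
          rw [hl, List.prod_cons, inv_mul_cancel_left]
          exact isPositive_list_prod fun u hu => (hprop u (List.mem_cons_of_mem _ hu)).1.isPositive
      -- A common prefix `a` makes `s * a` a simple prefix of `x`; maximality of `s` forces `a` to
      -- have exponent sum 0.
      have h1 : IsSimple (s * a) := by
        refine ⟨by simpa [IsPrefix] using hs.isPositive.mul ha, ?_⟩
        simpa [IsPrefix, rightComplement, mul_assoc] using has
      have h2 : IsPrefix (s * a) x := by
        rw [IsPrefix]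
        convert IsPositive.mul hat htl using 1
        group
      have h3 := hmax _ h1 h2
      rw [exponentSum_mul] at h3
      exact ha.eq_one (by omega)

/-- The index `i` serves to witness `n ≥ 2`; without generators `Δ = 1`. -/
theorem exponentSum_garside_pos (i : Fin (n - 1)) : 0 < exponentSum (garside n) := by
  have := (isSimple_sigma i).exponentSum_le
  rw [exponentSum_sigma] at this
  omega

/-- On at least two strands, every positive braid has a left normal form. -/
theorem IsPositive.exists_isLeftNormalForm (i : Fin (n - 1)) {x : BraidGroup n}
    (hx : IsPositive x) : ∃ p l, IsLeftNormalForm x p l := by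
  have hpos := exponentSum_garside_pos i
  obtain ⟨p, hp, hmax⟩ := Int.exists_greatest_of_bdd
    (P := fun q : ℤ => IsPositive (garside n ^ (-q) * x)) ⟨exponentSum x, fun q hq => by
      have h := hq.exponentSum_nonneg
      have h0 := hx.exponentSum_nonneg
      rw [exponentSum_mul, exponentSum_zpow] at h
      by_contra hlt
      nlinarith⟩ ⟨0, by simpa using hx⟩
  obtain ⟨l, hl, hprop, hchain⟩ := hp.exists_leftWeighted (fun h => by
    have := hmax (p + 1) (by
      rw [IsPrefix] at h
      convert h using 1
      group)
    omega)
  exact ⟨p, l, by rw [← hl, ← mul_assoc, ← zpow_add]; simp, ⟨hp, fun q hq => hmax q hq⟩, hprop,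
    hchain⟩

theorem IsPositive.exists_isLeftNormalForm_canonicalLength (i : Fin (n - 1)) {x : BraidGroup n}
    (hx : IsPositive x) : ∃ p l, IsLeftNormalForm x p l ∧ l.length = canonicalLength x := by
  obtain ⟨p, l, h⟩ := hx.exists_isLeftNormalForm i
  exact Nat.sInf_mem (s := {r : ℕ | ∃ (p : ℤ) (l : List (BraidGroup n)),
    IsLeftNormalForm x p l ∧ l.length = r}) ⟨_, p, l, h, rfl⟩

theorem exponentSum_list_prod_le {l : List (BraidGroup n)} (h : ∀ s ∈ l, IsSimple s) :
    exponentSum l.prod ≤ l.length * exponentSum (garside n) := by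
  induction l with
  | nil => simp
  | cons s l ih =>
    have h1 := (h s (by simp)).exponentSum_le
    have h2 := ih fun t ht => h t (List.mem_cons_of_mem _ ht)
    rw [List.prod_cons, exponentSum_mul, List.length_cons]
    push_cast
    linarith

/-! ### Palindromic-free braids -/

/-- The only positive palindromic-free braid with prefix `Δ` is possibly `Δ` itself. -/
theorem IsPositivePalindromicFree.eq_garside {x : BraidGroup n}
    (hx : IsPositivePalindromicFree x) (hΔ : IsPrefix (garside n) x) : x = garside n := by
  rcases IsPositive.eq_one_or_mul_sigma hΔ with h | ⟨i, y, hy, h⟩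
  · exact (inv_mul_eq_one.1 h).symm
  -- If `x = Δ y σ_i`, then `σ_i⁻¹ x σ_i⁻¹ = (σ_i⁻¹ Δ) y` is positive.
  · refine absurd ?_ (hx.2 i)
    rw [inv_mul_eq_iff_eq_mul.1 h]
    convert (isPrefix_sigma_garside i).mul hy using 1
    group

/-- Either the power of `Δ` is 0 and each factor contributes at most the exponent sum of `Δ`, or `x
= Δ`; the `+ 1` covers the latter. -/
theorem IsPositivePalindromicFree.exponentSum_le {x : BraidGroup n}
    (hx : IsPositivePalindromicFree x) :
    exponentSum x ≤ (canonicalLength x + 1) * exponentSum (garside n) := by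
  have hΔ := (isPositive_garside n).exponentSum_nonneg
  -- The case `x = 1` absorbs `n ≤ 1`; otherwise a first letter supplies the index that normal forms
  -- require.
  rcases hx.1.eq_one_or_sigma_mul with rfl | ⟨i, -⟩
  · rw [exponentSum_one]
    positivity
  obtain ⟨p, l, h, hr⟩ := hx.1.exists_isLeftNormalForm_canonicalLength i
  have hp : 0 ≤ p := h.isGreatest.2 (by simpa using hx.1)
  rw [← hr]
  rcases hp.eq_or_lt with rfl | hp
  · have h1 := exponentSum_list_prod_le fun s hs => (h.proper s hs).1
    rw [h.eq_prod, zpow_zero, one_mul]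
    linarith
  · have h1 : IsPrefix (garside n) x := by
      have h2 := ((isPositive_garside n).pow (p - 1).toNat).mul h.isGreatest.1
      rw [← zpow_natCast, Int.toNat_of_nonneg (by omega)] at h2
      rw [IsPrefix]
      convert h2 using 1
      group
    have : 0 ≤ (l.length : ℤ) * exponentSum (garside n) := by positivity
    rw [hx.eq_garside h1]
    linarith

/-! ### Reduction to positive palindromic-free braids, and the conclusion -/

/-- Every braid becomes positive when it is multiplied by a large power of `Δ`. -/
theorem exists_isPositive_mul_garside_pow (x : BraidGroup n) :
    ∃ k : ℕ, IsPositive (x * garside n ^ k) := by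
  have hx : x ∈ Subgroup.closure (Set.range (sigma : Fin (n - 1) → BraidGroup n)) := by
    have : Subgroup.closure (Set.range (sigma : Fin (n - 1) → BraidGroup n)) = ⊤ :=
      PresentedGroup.closure_range_of _
    rw [this]
    trivial
  induction hx using Subgroup.closure_induction_left with
  | one => exact ⟨0, by simpa using isPositive_one⟩
  | mul_left a ha y _ ih =>
    obtain ⟨i, rfl⟩ := ha
    obtain ⟨k, hk⟩ := ih
    exact ⟨k, by rw [mul_assoc]; exact (isPositive_sigma i).mul hk⟩
  | inv_mul_cancel a ha y _ ih =>
    obtain ⟨i, rfl⟩ := ha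
    obtain ⟨k, hk⟩ := ih
    refine ⟨k + 1, ?_⟩
    -- `σ_i⁻¹ y Δ ^ (k + 1) = (σ_i⁻¹ Δ) (Δ⁻¹ (y Δ ^ k) Δ)`.
    convert (isPrefix_sigma_garside i).mul hk.conj_garside using 1
    rw [pow_succ]
    group

theorem epsilon_sigma (i : Fin (n - 1)) : epsilon n (sigma i) = (sigma i)⁻¹ := epsilonHom_sigma i

/-- `x ↦ (ε x)⁻¹` fixes the generators and reverses products. -/
theorem IsPositive.epsilon_inv {x : BraidGroup n} (hx : IsPositive x) :
    IsPositive (epsilon n x)⁻¹ := by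
  induction hx using Submonoid.closure_induction with
  | mem x hx =>
    obtain ⟨i, rfl⟩ := hx
    rw [epsilon_sigma, inv_inv]
    exact isPositive_sigma i
  | one => simpa using isPositive_one
  | mul x y _ _ ihx ihy =>
    rw [map_mul, mul_inv_rev]
    exact ihy.mul ihx

/-- Every braid is `ε`-twisted conjugated to a positive one. -/
theorem exists_isPositive_twistedConj (x : BraidGroup n) :
    ∃ y, IsPositive y ∧ TwistedConj (epsilon n) x y := by
  obtain ⟨k, hk⟩ := exists_isPositive_mul_garside_pow x
  refine ⟨_, ?_, garside n ^ k, rfl⟩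
  rw [mul_assoc]
  exact ((isPositive_garside n).pow k).epsilon_inv.mul hk

theorem IsPositive.nonempty_PF {x : BraidGroup n} (hx : IsPositive x) : (PF x).Nonempty := by
  obtain ⟨k, hk⟩ : ∃ k : ℕ, exponentSum x ≤ k := ⟨_, Int.self_le_toNat _⟩
  induction k using Nat.strong_induction_on generalizing x with
  | _ k ih =>
    by_cases h : ∀ i : Fin (n - 1), ¬ IsPositive ((sigma i)⁻¹ * x * (sigma i)⁻¹)
    · exact ⟨x, ⟨hx, h⟩, TwistedConj.refl _ _⟩
    · push Not at h
      obtain ⟨i, hi⟩ := h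
      have h0 := hi.exponentSum_nonneg
      have h1 : exponentSum ((sigma i)⁻¹ * x * (sigma i)⁻¹) = exponentSum x - 2 := by
        simp only [exponentSum_mul, exponentSum_inv, exponentSum_sigma]
        ring
      -- The exponent sum drops by 2 and stays nonnegative, so `k ≥ 2` and the truncated subtraction
      -- is harmless.
      obtain ⟨y, hy, hc⟩ := ih (k - 1) (by omega) hi (by omega)
      have hxc : TwistedConj (epsilon n) x ((sigma i)⁻¹ * x * (sigma i)⁻¹) :=
        ⟨(sigma i)⁻¹, by rw [map_inv, epsilon_sigma, inv_inv]⟩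
      exact ⟨y, hy, hxc.trans hc⟩

theorem PF_eq_of_twistedConj {x y : BraidGroup n} (h : TwistedConj (epsilon n) x y) :
    PF x = PF y := by
  ext z
  exact and_congr_right fun _ => ⟨h.symm.trans, h.trans⟩

theorem nonempty_PF (x : BraidGroup n) : (PF x).Nonempty := by
  obtain ⟨y, hy, h⟩ := exists_isPositive_twistedConj x
  rw [PF_eq_of_twistedConj h]
  exact hy.nonempty_PF

theorem nonempty_MPF (x : BraidGroup n) : (MPF x).Nonempty := by
  obtain ⟨y, hy, hmin⟩ := (measure (canonicalLength (n := n))).wf.has_min (PF x) (nonempty_PF x)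
  exact ⟨y, hy, fun z hz => not_lt.1 (hmin z hz)⟩

theorem finite_MPF (x : BraidGroup n) : (MPF x).Finite := by
  obtain ⟨y, hy, -⟩ := nonempty_MPF x
  -- Every element of `MPF x` has canonical length at most that of `y`, which gives a uniform bound
  -- on exponent sums.
  refine (finite_isPositive_exponentSum_le
    ((canonicalLength y + 1) * exponentSum (garside n))).subset fun z hz => ⟨hz.1.1.1, ?_⟩
  have hΔ := (isPositive_garside n).exponentSum_nonneg
  refine hz.1.1.exponentSum_le.trans (mul_le_mul_of_nonneg_right ?_ hΔ)
  have := hz.2 y hy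
  omega

end BraidGroup

theorem mainTheorem7 (n : ℕ) (x : BraidGroup n) :
    (BraidGroup.MPF x).Nonempty ∧ (BraidGroup.MPF x).Finite ∧
      ∀ y : BraidGroup n, TwistedConj (BraidGroup.epsilon n) x y →
        BraidGroup.MPF x = BraidGroup.MPF y :=
  ⟨BraidGroup.nonempty_MPF x, BraidGroup.finite_MPF x, fun y h => by
    simp only [BraidGroup.MPF, BraidGroup.PF_eq_of_twistedConj h]⟩
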